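/- Let $\mathcal N$ be a countably infinite alphabet of names. For $m,n\ge 0$, an assignment is a function $H$ from the places $\{1,\dots,m+n\}$ to finite subsets of $\mathcal N$ with $|H(i)|\le 1$ for $i>m$ (places $i\le m$ are called histories, places $i>m$ registers). A history-register automaton (HRA) of type $(m,n)$ is a tuple $\langle Q,q_0,H_0,\delta,F\rangle$ with a finite set $Q$ of states, an initial state $q_0\in Q$, an initial assignment $H_0$, final states $F\subseteq Q$, and a transition relation $\delta\subseteq Q\times L\times Q$, where $L$ consists of the pairs $(X,X')$ of sets of places and of the single sets $X$ of places. In a configuration $(q,H)$: - a transition $(q,(X,X'),q')\in\delta$ accepts any name $a$ that belongs to $H(i)$ for exactly the places $i\in X$, and leads to $(q',H')$, where $H'(i)=H(i)\setminus\{a\}$ for $i\notin X'$, $H'(i)=H(i)\cup\{a\}$ for histories $i\in X'$, and $H'(i)=\{a\}$ for registers $i\in X'$; - a transition $(q,X,q')\in\delta$ accepts nothing ($\epsilon$) and leads to $(q',H')$, where $H'(i)=\emptyset$ for $i\in X$ and $H'(i)=H(i)$ otherwise. The language $\mathcal L(\mathcal A)\subseteq\mathcal N^*$ of an HRA $\mathcal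 A$ is the set of words accepted along finite paths of configurations from $(q_0,H_0)$ to some $(q,H)$ with $q\in F$. **Proposition.** Language emptiness of history-register automata is decidable: there is an algorithm that, given $m,n\ge 0$ and a finite description of an HRA $\mathcal A$ of type $(m,n)$, decides whether $\mathcal L(\mathcal A)=\emptyset$. -/

import Mathlib

universe u v

/-- The places of a machine with `m` histories and `n` registers: the place `i` is a history if
`i < m` and a register otherwise. -/
abbrev Place (m n : ℕ) : Type := Fin (m + n)

/-- An assignment maps every place to a finite set of names, and every register to a set with at
most one element. -/
@[ext]
structure Assignment (N : Type u) (m n : ℕ) : Type u where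
  val : Place m n → Finset N
  card_le_one : ∀ i : Place m n, m ≤ (i : ℕ) → (val i).card ≤ 1

namespace Assignment

variable {N : Type u} {m n : ℕ}

/-- The names that appear precisely in the places of `X`. For `X = ∅` these are the names that
appear in no place. -/
def at_ (H : Assignment N m n) (X : Finset (Place m n)) : Set N :=
  (⋂ i ∈ X, (H.val i : Set N)) \ ⋃ i ∉ X, (H.val i : Set N)

/-- All places of `X` are emptied. -/
def reset (H : Assignment N m n) (X : Finset (Place m n)) : Assignment N m n where
  val i := if i ∈ X then ∅ else H.val i
  card_le_one i hi := by
    split_ifs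
    · simp
    · exact H.card_le_one i hi

/-- The name `a` is removed from all places and inserted in the places of `X`: it is added to the
histories of `X`, and it replaces the contents of the registers of `X`. -/
def move [DecidableEq N] (H : Assignment N m n) (a : N) (X : Finset (Place m n)) :
    Assignment N m n where
  val i :=
    if i ∈ X then
      if (i : ℕ) < m then insert a (H.val i) else {a}
    else (H.val i).erase a
  card_le_one i hi := by
    split_ifs with h1 h2
    · omega
    · simp
    · exact Finset.card_erase_le.trans (H.card_le_one i hi)

end Assignment

/-- Labels: a pair `(X, X')` of sets of places (accepting a name), or one set `X` of places
(a reset). -/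
abbrev Label (m n : ℕ) : Type :=
  (Finset (Place m n) × Finset (Place m n)) ⊕ Finset (Place m n)

/-- A history-register automaton of type `(m, n)` over the names `N`. -/
structure HRA (N : Type u) (m n : ℕ) : Type (max u (v + 1)) where
  State : Type v
  finite_state : Finite State
  init : State
  initAssign : Assignment N m n
  trans : Set (State × Label m n × State)
  final : Set State

namespace HRA

variable {N : Type u} [DecidableEq N] {m n : ℕ}

/-- Configurations. -/
abbrev Config (A : HRA.{u, v} N m n) : Type (max u v) := A.State × Assignment N m n

/-- The edges of the configuration graph; `some a` is the name `a` and `none` stands for `ε`. -/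
inductive Step (A : HRA.{u, v} N m n) : A.Config → Option N → A.Config → Prop
  | accept {q q' : A.State} {X X' : Finset (Place m n)} {H : Assignment N m n} {a : N}
      (ht : (q, Sum.inl (X, X'), q') ∈ A.trans) (ha : a ∈ H.at_ X) :
      Step A (q, H) (some a) (q', H.move a X')
  | reset {q q' : A.State} {X : Finset (Place m n)} {H : Assignment N m n}
      (ht : (q, Sum.inr X, q') ∈ A.trans) :
      Step A (q, H) none (q', H.reset X)

/-- `A.Run c w c'`: there is a finite path from `c` to `c'` in the configuration graph whose
labels, with all `ε` dropped, form the word `w`. -/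
inductive Run (A : HRA.{u, v} N m n) : A.Config → List N → A.Config → Prop
  | refl (c : A.Config) : Run A c [] c
  | step {c c' c'' : A.Config} {x : Option N} {w : List N}
      (h : A.Step c x c') (hr : Run A c' w c'') : Run A c (x.toList ++ w) c''

/-- The accepted language. -/
def language (A : HRA.{u, v} N m n) : Set (List N) :=
  {w | ∃ q H, A.Run (A.init, A.initAssign) w (q, H) ∧ q ∈ A.final}

end HRA

/-! ### Finite presentations, the inputs of the emptiness problem -/

/-- Codes of labels: places are written as numbers and sets of places as lists. -/
abbrev LabelCode : Type := (List ℕ × List ℕ) ⊕ List ℕ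

/-- A written description `(k, hs, rs, ts, fs)` of an automaton:
the states are `0, …, k`, the initial state is `0`,
`hs` lists the initial contents of the histories, `rs` those of the registers,
`ts` lists the transitions and `fs` the final states. -/
abbrev HRACode : Type :=
  ℕ × List (List ℕ) × List (Option ℕ) × List (ℕ × LabelCode × ℕ) × List ℕ

/-- The set of the places that occur in a list. -/
def decodePlaces (m n : ℕ) (l : List ℕ) : Finset (Place m n) :=
  Finset.univ.filter fun i => (i : ℕ) ∈ l

/-- The label that a code stands for. -/
def decodeLabel (m n : ℕ) : LabelCode → Label m n :=
  Sum.map (Prod.map (decodePlaces m n) (decodePlaces m n)) (decodePlaces m n)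

/-- The assignment given by the contents of the histories and of the registers; the number `k`
stands for the `k`-th name. Places that are not listed are empty. -/
def decodeAssignment (N : Type u) [DecidableEq N] [Denumerable N] (m n : ℕ)
    (hs : List (List ℕ)) (rs : List (Option ℕ)) : Assignment N m n where
  val i :=
    if (i : ℕ) < m then ((hs.getD i []).map (Denumerable.ofNat N)).toFinset
    else ((rs.getD (i - m) none).map (Denumerable.ofNat N)).toFinset
  card_le_one i hi := by
    rw [if_neg (by omega)]
    cases rs.getD (i - m) none <;> simp

/-- The `(m, n)`-HRA that a code stands for. -/
def HRACode.toHRA (N : Type u) [DecidableEq N] [Denumerable N] (m n : ℕ) :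
    HRACode → HRA.{u, 0} N m n
  | (k, hs, rs, ts, fs) =>
    { State := Fin (k + 1)
      finite_state := inferInstance
      init := 0
      initAssign := decodeAssignment N m n hs rs
      trans := {t | ∃ s ∈ ts, s.1 = (t.1 : ℕ) ∧ decodeLabel m n s.2.1 = t.2.1 ∧
        s.2.2 = (t.2.2 : ℕ)}
      final := {q | (q : ℕ) ∈ fs} }

/-! ### Every automaton has a code -/

/-- `e` identifies the automata `A` and `B` up to the names of their states. -/
structure HRA.IsIso {N : Type u} {m n : ℕ} (A : HRA.{u, v} N m n) (B : HRA.{u, 0} N m n)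
    (e : A.State ≃ B.State) : Prop where
  init_eq : e A.init = B.init
  initAssign_eq : A.initAssign = B.initAssign
  trans_iff : ∀ q l q', (q, l, q') ∈ A.trans ↔ (e q, l, e q') ∈ B.trans
  final_iff : ∀ q, q ∈ A.final ↔ e q ∈ B.final

/-- Isomorphic automata accept the same language. -/
theorem HRA.IsIso.language_eq {N : Type u} [DecidableEq N] {m n : ℕ} {A : HRA.{u, v} N m n}
    {B : HRA.{u, 0} N m n} {e : A.State ≃ B.State} (h : A.IsIso B e) :
    A.language = B.language := by
  have h1 : ∀ c w c', A.Run c w c' → B.Run (e c.1, c.2) w (e c'.1, c'.2) := by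
    intro c w c' hr
    induction hr with
    | refl c => exact .refl _
    | step hs _ ih =>
      refine .step ?_ ih
      cases hs with
      | accept ht ha => exact .accept ((h.trans_iff _ _ _).1 ht) ha
      | reset ht => exact .reset ((h.trans_iff _ _ _).1 ht)
  have h2 : ∀ c w c', B.Run c w c' → A.Run (e.symm c.1, c.2) w (e.symm c'.1, c'.2) := by
    intro c w c' hr
    induction hr with
    | refl c => exact .refl _
    | step hs _ ih =>
      refine .step ?_ ih
      cases hs with
      | accept ht ha => exact .accept ((h.trans_iff _ _ _).2 (by simpa using ht)) ha
      | reset ht => exact .reset ((h.trans_iff _ _ _).2 (by simpa using ht))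
  ext w
  constructor
  · rintro ⟨q, H, hr, hq⟩
    refine ⟨e q, H, ?_, (h.final_iff q).1 hq⟩
    have := h1 _ _ _ hr
    simpa [h.init_eq, h.initAssign_eq] using this
  · rintro ⟨q, H, hr, hq⟩
    refine ⟨e.symm q, H, ?_, (h.final_iff _).2 (by simpa using hq)⟩
    have := h2 _ _ _ hr
    simpa [← h.init_eq, h.initAssign_eq] using this

theorem decodePlaces_surjective (m n : ℕ) : Function.Surjective (decodePlaces m n) := fun X =>
  ⟨X.toList.map Fin.val, by ext i; simp [decodePlaces, Fin.val_inj]⟩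

theorem decodeLabel_surjective (m n : ℕ) : Function.Surjective (decodeLabel m n) :=
  Sum.map_surjective.2 ⟨(decodePlaces_surjective m n).prodMap (decodePlaces_surjective m n),
    decodePlaces_surjective m n⟩

theorem decodeAssignment_surjective (N : Type u) [DecidableEq N] [Denumerable N] (m n : ℕ)
    (H : Assignment N m n) : ∃ hs rs, decodeAssignment N m n hs rs = H := by
  have hreg : ∀ j : Fin n, ∃ o : Option ℕ,
      (o.map (Denumerable.ofNat N)).toFinset = H.val (Fin.natAdd m j) := by
    intro j
    rcases Finset.card_le_one_iff_subset_singleton.1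
      (H.card_le_one (Fin.natAdd m j) (by simp)) with ⟨a, ha⟩
    rcases Finset.subset_singleton_iff.1 ha with h | h
    · exact ⟨none, by simp [h]⟩
    · exact ⟨some (Encodable.encode a), by simp [h]⟩
  choose r hr using hreg
  refine ⟨List.ofFn fun j : Fin m => (H.val (Fin.castAdd n j)).toList.map Encodable.encode,
    List.ofFn r, ?_⟩
  ext1
  funext i
  refine Fin.addCases (fun j => ?_) (fun j => ?_) i
  · ext a
    simp [decodeAssignment]
  · simp [decodeAssignment, hr]

/-- Every automaton is, up to the names of its states, the automaton of some code. -/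
theorem HRA.exists_code {N : Type u} [DecidableEq N] [Denumerable N] {m n : ℕ}
    (A : HRA.{u, v} N m n) :
    ∃ (c : HRACode) (e : A.State ≃ (c.toHRA N m n).State), A.IsIso (c.toHRA N m n) e := by
  have := A.finite_state
  obtain ⟨k, ⟨e0⟩⟩ := Finite.exists_equiv_fin A.State
  obtain ⟨k, rfl⟩ : ∃ k', k = k' + 1 := ⟨k - 1, by have := (e0 A.init).pos; omega⟩
  let e : A.State ≃ Fin (k + 1) := e0.trans (Equiv.swap (e0 A.init) 0)
  have he : e A.init = 0 := by simp [e]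
  obtain ⟨hs, rs, hH⟩ := decodeAssignment_surjective N m n A.initAssign
  choose g hg using decodeLabel_surjective m n
  have hfT : A.trans.Finite := Set.toFinite _
  have hfF : A.final.Finite := Set.toFinite _
  refine ⟨(k, hs, rs, hfT.toFinset.toList.map fun t => ((e t.1 : ℕ), g t.2.1, (e t.2.2 : ℕ)),
    hfF.toFinset.toList.map fun q => (e q : ℕ)), e, he, hH.symm, ?_, ?_⟩
  · intro q l q'
    simp only [HRACode.toHRA, List.mem_map, Finset.mem_toList,
      Set.Finite.mem_toFinset]
    constructor
    · intro h
      exact ⟨_, ⟨_, h, rfl⟩, rfl, hg l, rfl⟩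
    · rintro ⟨_, ⟨⟨p, l', p'⟩, h, rfl⟩, h1, h2, h3⟩
      have h1' : p = q := e.injective (Fin.ext h1)
      have h3' : p' = q' := e.injective (Fin.ext h3)
      have h2' : l' = l := (hg l').symm.trans h2
      subst h1' h2' h3'
      exact h
  · intro q
    change q ∈ A.final ↔ (e q : ℕ) ∈ hfF.toFinset.toList.map fun q => (e q : ℕ)
    simp [Fin.val_inj]

/-!
The names are interchangeable, so a configuration of an automaton is determined, up to a
permutation of the names, by its state and by how many names lie in exactly the places of `X`, for
every nonempty set `X` of places. Here it is written as a word over the finite alphabet of sets of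
places: every name of a finite list, which includes all names in the assignment, contributes the
set of places that hold it (`Assignment.Represents`). Accepting a name rewrites one letter and
deletes, from all other letters, the registers that the name enters; a reset deletes places from
all letters; and the empty letter may be added at any time, for a fresh name. With these moves the
words and the automaton simulate each other (`HRACode.exists_wordStep`, `HRACode.exists_step`), so
emptiness of the language is unreachability of the final states in a word system
(`HRACode.language_eq_empty_iff`). The words need not respect the bound on the contents of
registers, which is only an invariant of the moves.

Word systems are well-structured. A configuration can simulate all of its subwords
(`WordSystem.Step.mono`), and by Higman's lemma the subword order is a well-quasi-order
(`WordSystem.partiallyWellOrderedOn_le`). Hence the configurations from which a final state can be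
reached form an upward closed set with a finite basis. Conversely, any finite set whose upward
closure contains the final configurations, omits the initial one and is closed under predecessors
proves that no final state is reachable. Closure under predecessors is a finite condition, as only
predecessors with at most one letter more than a basis element matter
(`WordSystem.Step.exists_short`).

So both reachability and unreachability have finite certificates, a number of moves and a basis,
which are checked by primitive recursive tests. Both are recursively enumerable, and by Post's
theorem reachability is decidable (`WordSystem.computablePred_not_reaches`).
-/

/-! ### Word systems -/

/-- Every element of a partially well-ordered set lies above some element of a finite subset. -/
theorem Set.PartiallyWellOrderedOn.exists_finset_basis {α : Type*} {r : α → α → Prop}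
    {s : Set α} (hs : s.PartiallyWellOrderedOn r) :
    ∃ t : Finset α, (∀ b ∈ t, b ∈ s) ∧ ∀ a ∈ s, ∃ b ∈ t, r b a := by
  by_contra! hcon
  obtain ⟨f, hf, hr⟩ := exists_seq_of_forall_finset_exists (· ∈ s) (fun x y => ¬ r x y) hcon
  obtain ⟨i, j, hij, h⟩ := Set.partiallyWellOrderedOn_iff_exists_lt.1 hs f hf
  exact hr i j hij h

/-- A configuration of a word system: a control state, and a word that lists the letter of each
known name. A letter is the list of the places that hold the name. -/
abbrev WordConfig : Type := ℕ × List (List ℕ)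

/-- A rule `(q, x, x', R, q')`: go from state `q` to `q'`, rewrite one occurrence of the letter `x`
to `x'`, and delete the places of `R` from all other letters. -/
abbrev WordRule : Type := ℕ × List ℕ × List ℕ × List ℕ × ℕ

namespace WordSystem

/-- The letter `y` without the places of `R`. -/
def strip (R y : List ℕ) : List ℕ := y.filter (· ∉ R)

/-- The moves of the word system with rules `rs`: a name that is in no place may be noticed, and
a rule may be applied to any occurrence of the letter it rewrites. -/
inductive Step (rs : List WordRule) : WordConfig → WordConfig → Prop
  | insert (q : ℕ) (w : List (List ℕ)) : Step rs (q, w) (q, [] :: w)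
  | rule {q : ℕ} {x x' R : List ℕ} {q' : ℕ} (h : (q, x, x', R, q') ∈ rs) (u v : List (List ℕ)) :
      Step rs (q, u ++ x :: v) (q', u.map (strip R) ++ x' :: v.map (strip R))

/-- The order of configurations: equal states and a subword. -/
def Le (c d : WordConfig) : Prop := c.1 = d.1 ∧ c.2.Sublist d.2

theorem Le.trans {c d e : WordConfig} (h : Le c d) (h' : Le d e) : Le c e :=
  ⟨h.1.trans h'.1, h.2.trans h'.2⟩

/-- Some state of `fs` can be reached from `c`. -/
def Reaches (rs : List WordRule) (fs : List ℕ) (c : WordConfig) : Prop :=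
  ∃ d, Relation.ReflTransGen (Step rs) c d ∧ d.1 ∈ fs

/-- Larger configurations can simulate smaller ones: the additional letters are at most
stripped. -/
theorem Step.mono {rs : List WordRule} {c c' d : WordConfig} (h : Step rs c c') (hd : Le c d) :
    ∃ d', Step rs d d' ∧ Le c' d' := by
  obtain ⟨q, w⟩ := d
  obtain ⟨h1, h2⟩ := hd
  cases h with
  | insert p w' =>
    obtain rfl : p = q := h1
    exact ⟨_, .insert p w, rfl, h2.cons_cons _⟩
  | @rule p x x' R p' hr u v =>
    obtain rfl : p = q := h1
    obtain ⟨u', t, rfl, hu, ht⟩ := List.append_sublist_iff.1 h2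
    obtain ⟨s, v', rfl, hx, hv⟩ := List.cons_sublist_iff.1 ht
    obtain ⟨s1, s2, rfl⟩ := List.append_of_mem hx
    refine ⟨(p', (u' ++ s1).map (strip R) ++ x' :: (s2 ++ v').map (strip R)), ?_, rfl, ?_⟩
    · simpa using Step.rule hr (u' ++ s1) (s2 ++ v')
    · refine List.Sublist.append ?_ (List.Sublist.cons_cons _ ?_)
      · exact (hu.trans (List.sublist_append_left _ _)).map _
      · exact (hv.trans (List.sublist_append_right _ _)).map _

theorem Reaches.mono {rs : List WordRule} {fs : List ℕ} {c d : WordConfig}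
    (h : Reaches rs fs c) (hd : Le c d) : Reaches rs fs d := by
  obtain ⟨e, hce, he⟩ := h
  induction hce using Relation.ReflTransGen.head_induction_on generalizing d with
  | refl => exact ⟨d, .refl, hd.1 ▸ he⟩
  | head hs _ ih =>
    obtain ⟨d', hd1, hd2⟩ := hs.mono hd
    obtain ⟨f, hf, hff⟩ := ih hd2
    exact ⟨f, .head hd1 hf, hff⟩

/-- A move that leads above `b` is already possible, with a result above `b`, from a subword that
is at most one letter longer than the word of `b`. -/
theorem Step.exists_short {rs : List WordRule} {c c' b : WordConfig} (h : Step rs c c')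
    (hb : Le b c') : ∃ d d', Le d c ∧ Step rs d d' ∧ Le b d' ∧ d.2.length ≤ b.2.length + 1 := by
  obtain ⟨q, y⟩ := b
  obtain ⟨h1, h2⟩ := hb
  -- The letter `z` in front is the one that the move writes. The other letters of `z :: v.map g`
  -- that `y` does not use are dropped from `v`.
  have key : ∀ (g : List ℕ → List ℕ) (z : List ℕ) (y v : List (List ℕ)),
      y.Sublist (z :: v.map g) →
      ∃ v' : List (List ℕ), v'.Sublist v ∧ y.Sublist (z :: v'.map g) ∧ v'.length ≤ y.length := by
    intro g z y v hy
    rcases List.sublist_cons_iff.1 hy with h | ⟨r, rfl, h⟩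
    · obtain ⟨v', hv', rfl⟩ := List.sublist_map_iff.1 h
      exact ⟨v', hv', List.sublist_cons_self _ _, by simp⟩
    · obtain ⟨v', hv', rfl⟩ := List.sublist_map_iff.1 h
      exact ⟨v', hv', List.Sublist.refl _, by simp⟩
  cases h with
  | insert p w =>
    obtain rfl : q = p := h1
    obtain ⟨v, hv, hy, hl⟩ := key id [] y w (by simpa using h2)
    exact ⟨(q, v), _, ⟨rfl, hv⟩, .insert q v, ⟨rfl, by simpa using hy⟩, by simp; omega⟩
  | @rule p x x' R p' hr u v =>
    obtain rfl : q = p' := h1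
    obtain ⟨y1, y2, rfl, hy1, hy2⟩ := List.sublist_append_iff.1 h2
    obtain ⟨u', hu', rfl⟩ := List.sublist_map_iff.1 hy1
    obtain ⟨v', hv', hy, hl⟩ := key _ _ _ _ hy2
    exact ⟨(p, u' ++ x :: v'), _, ⟨rfl, hu'.append (hv'.cons_cons _)⟩, .rule hr u' v',
      ⟨rfl, (List.Sublist.refl _).append hy⟩, by simp; omega⟩

/-- Some configuration of `B` is below `c`. -/
def Covers (B : List WordConfig) (c : WordConfig) : Prop := ∃ b ∈ B, Le b c

theorem Covers.mono {B : List WordConfig} {c d : WordConfig} (h : Covers B c) (hd : Le c d) :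
    Covers B d := by
  obtain ⟨b, hb, hbc⟩ := h
  exact ⟨b, hb, hbc.trans hd⟩

/-- The words of length at most `K` over the alphabet `A`. -/
def words (A : List (List ℕ)) (K : ℕ) : List (List (List ℕ)) :=
  Nat.rec [[]] (fun _ W => [] :: W.flatMap fun w => A.map fun x => x :: w) K

theorem mem_words {A : List (List ℕ)} {K : ℕ} {w : List (List ℕ)} :
    w ∈ words A K ↔ w.length ≤ K ∧ ∀ x ∈ w, x ∈ A := by
  induction K generalizing w with
  | zero => cases w <;> simp [words]
  | succ K ih =>
    have h : words A (K + 1) = [] :: (words A K).flatMap fun w => A.map fun x => x :: w := rfl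
    cases w with
    | nil => simp [h]
    | cons x w =>
      simp only [h, List.mem_cons, reduceCtorEq, List.mem_flatMap, List.mem_map, List.cons.injEq,
        false_or, ih]
      constructor
      · rintro ⟨w', ⟨h1, h2⟩, x', hx, rfl, rfl⟩
        refine ⟨by simpa using h1, ?_⟩
        rintro y (rfl | hy)
        exacts [hx, h2 y hy]
      · rintro ⟨h1, h2⟩
        exact ⟨w, ⟨by simpa using h1, fun y hy => h2 y (.inr hy)⟩, x, h2 x (.inl rfl), rfl, rfl⟩

/-- The results of the moves from `c`. -/
def succs (rs : List WordRule) (c : WordConfig) : List WordConfig :=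
  (c.1, [] :: c.2) :: rs.flatMap fun r =>
    if r.1 = c.1 then
      (List.range c.2.length).filterMap fun i =>
        if c.2[i]? = some r.2.1 then
          some (r.2.2.2.2, (c.2.map (strip r.2.2.2.1)).set i r.2.2.1) else none
    else []

theorem mem_succs {rs : List WordRule} {c c' : WordConfig} : c' ∈ succs rs c ↔ Step rs c c' := by
  obtain ⟨p, w⟩ := c
  simp only [succs, List.mem_cons, List.mem_flatMap]
  constructor
  · rintro (rfl | ⟨⟨q, x, x', R, q'⟩, hr, h⟩)
    · exact .insert p w
    · split_ifs at h with hq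
      · obtain rfl : q = p := hq
        simp only [List.mem_filterMap, List.mem_range, Option.ite_none_right_eq_some] at h
        obtain ⟨i, hi, hx, h⟩ := h
        obtain rfl := Option.some.inj h
        obtain ⟨_, hx⟩ := List.getElem?_eq_some_iff.1 hx
        have hw : w = w.take i ++ x :: w.drop (i + 1) := by
          rw [← hx, List.cons_getElem_drop_succ, List.take_append_drop]
        have := Step.rule hr (w.take i) (w.drop (i + 1))
        rw [← hw] at this
        rwa [List.set_eq_take_append_cons_drop, if_pos (by simpa using hi), ← List.map_take,
          ← List.map_drop]
      · simp at h
  · intro h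
    cases h with
    | insert => exact .inl rfl
    | @rule q x x' R q' hr u v =>
      refine .inr ⟨_, hr, ?_⟩
      simp only [if_true, List.mem_filterMap, List.mem_range, Option.ite_none_right_eq_some]
      refine ⟨u.length, by simp, by simp, ?_⟩
      simp

/-- `B` generates an upward closed set of configurations that witnesses that no state of `fs` can
be reached from `c₀`: it holds all configurations with a state in `fs`, but not `c₀`, and it is
closed under predecessors. By `Step.exists_short` it suffices to consider predecessors with words
of length at most `K`, where `K` exceeds the length of all words in `B`. -/
def Certifies (A : List (List ℕ)) (rs : List WordRule) (fs : List ℕ) (c₀ : WordConfig)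
    (K : ℕ) (B : List WordConfig) : Prop :=
  (∀ b ∈ B, b.2.length < K) ∧ (∀ q ∈ fs, (q, []) ∈ B) ∧ ¬ Covers B c₀ ∧
    ∀ q ∈ rs.map Prod.fst ++ B.map Prod.fst, ∀ w ∈ words A K, ∀ c' ∈ succs rs (q, w),
      Covers B c' → Covers B (q, w)

/-- The words over the alphabet `A` are closed under the moves of the word system. -/
structure WellFormed (A : List (List ℕ)) (rs : List WordRule) : Prop where
  nil_mem : [] ∈ A
  strip_mem : ∀ x ∈ A, ∀ R, strip R x ∈ A
  write_mem : ∀ r ∈ rs, r.2.2.1 ∈ A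

theorem Step.mem_alphabet {A : List (List ℕ)} {rs : List WordRule} (hA : WellFormed A rs)
    {c c' : WordConfig} (h : Step rs c c') (hc : ∀ x ∈ c.2, x ∈ A) : ∀ x ∈ c'.2, x ∈ A := by
  cases h with
  | insert p w =>
    rintro x (_ | ⟨_, hx⟩)
    exacts [hA.nil_mem, hc x hx]
  | @rule p x x' R p' hr u v =>
    intro y hy
    simp only [List.mem_append, List.mem_cons, List.mem_map] at hy hc
    rcases hy with ⟨z, hz, rfl⟩ | rfl | ⟨z, hz, rfl⟩
    · exact hA.strip_mem z (hc z (.inl hz)) R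
    · exact hA.write_mem _ hr
    · exact hA.strip_mem z (hc z (.inr (.inr hz))) R

/-- Along a run from `c₀` no configuration is covered by `B`, as a covered successor would make its
predecessor covered. All configurations with a state in `fs` are covered. -/
theorem Certifies.not_reaches {A : List (List ℕ)} {rs : List WordRule} {fs : List ℕ}
    {c₀ : WordConfig} {K : ℕ} {B : List WordConfig} (hA : WellFormed A rs)
    (hc₀ : ∀ x ∈ c₀.2, x ∈ A) (h : Certifies A rs fs c₀ K B) : ¬ Reaches rs fs c₀ := by
  obtain ⟨hK, hfs, h₀, hpre⟩ := h
  rintro ⟨d, hd, hdf⟩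
  have key : (∀ x ∈ d.2, x ∈ A) ∧ ¬ Covers B d := by
    clear hdf
    induction hd with
    | refl => exact ⟨hc₀, h₀⟩
    | tail _ hs ih => ?_
    rename_i c c' _
    refine ⟨hs.mem_alphabet hA ih.1, fun ⟨b, hb, hbc⟩ => ih.2 ?_⟩
    obtain ⟨e, e', hec, hs', hbe, hl⟩ := hs.exists_short hbc
    have hcov : Covers B (e.1, e.2) := by
      refine hpre e.1 ?_ e.2 ?_ e' (mem_succs.2 hs') ⟨b, hb, hbe⟩
      · simp only [List.mem_append, List.mem_map]
        cases hs' with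
        | insert => exact .inr ⟨b, hb, hbe.1⟩
        | rule hr => exact .inl ⟨_, hr, rfl⟩
      · exact mem_words.2 ⟨hl.trans (hK b hb), fun x hx => ih.1 x (hec.2.subset hx)⟩
    exact hcov.mono hec
  exact key.2 ⟨(d.1, []), hfs _ hdf, rfl, List.nil_sublist _⟩

/-- **Higman's lemma** for configurations with finitely many states over a finite alphabet. -/
theorem partiallyWellOrderedOn_le (S : List ℕ) (A : List (List ℕ)) :
    {c : WordConfig | c.1 ∈ S ∧ ∀ x ∈ c.2, x ∈ A}.PartiallyWellOrderedOn Le := by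
  have h1 : {q | q ∈ S}.PartiallyWellOrderedOn (· = · : ℕ → ℕ → Prop) :=
    (List.finite_toSet S).partiallyWellOrderedOn
  have h2 : {w : List (List ℕ) | ∀ x ∈ w, x ∈ {x | x ∈ A}}.PartiallyWellOrderedOn
      (List.SublistForall₂ (· = ·)) :=
    Set.PartiallyWellOrderedOn.partiallyWellOrderedOn_sublistForall₂ _
      (List.finite_toSet A).partiallyWellOrderedOn
  have h3 := h1.prod h2
  rw [Set.partiallyWellOrderedOn_iff_exists_lt] at h3 ⊢
  intro f hf
  obtain ⟨i, j, hij, h, h'⟩ := h3 f hf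
  refine ⟨i, j, hij, h, ?_⟩
  obtain ⟨l, hl, hl'⟩ := List.sublistForall₂_iff.1 h'
  rw [List.forall₂_eq_eq_eq] at hl
  exact hl ▸ hl'

/-- The configurations from which `fs` can be reached form an upward closed set. If `c₀` is not one
of them, then a finite basis of this set is a certificate. -/
theorem exists_certifies {A : List (List ℕ)} {rs : List WordRule} {fs : List ℕ}
    {c₀ : WordConfig} (h : ¬ Reaches rs fs c₀) :
    ∃ K B, Certifies A rs fs c₀ K B := by
  let S := rs.map Prod.fst ++ fs
  have hU : {c : WordConfig | (c.1 ∈ S ∧ ∀ x ∈ c.2, x ∈ A) ∧ Reaches rs fs c}.PartiallyWellOrderedOn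
      Le := (partiallyWellOrderedOn_le S A).mono fun c hc => hc.1
  obtain ⟨t, ht, hbasis⟩ := hU.exists_finset_basis
  -- the configurations `(q, [])` are added since a final state is tested by membership
  let B := t.toList ++ fs.map fun q => (q, [])
  have hB : ∀ b ∈ B, (b.1 ∈ S ∧ ∀ x ∈ b.2, x ∈ A) ∧ Reaches rs fs b := by
    intro b hb
    rcases List.mem_append.1 hb with hb | hb
    · exact ht b (by simpa using hb)
    · obtain ⟨q, hq, rfl⟩ := List.mem_map.1 hb
      exact ⟨⟨List.mem_append_right _ hq, by simp⟩, ⟨_, .refl, hq⟩⟩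
  have hcov : ∀ c, Covers B c → Reaches rs fs c := fun c ⟨b, hb, hbc⟩ => (hB b hb).2.mono hbc
  refine ⟨(B.map fun b => b.2.length).sum + 1, B, fun b hb => ?_, fun q hq => ?_,
    fun hc => h (hcov _ hc), fun q hq w hw c' hc' hc => ?_⟩
  · exact Nat.lt_succ_of_le (List.le_sum_of_mem (List.mem_map_of_mem hb))
  · exact List.mem_append_right _ (List.mem_map_of_mem (f := fun q => (q, [])) hq)
  · obtain ⟨d, hd, hdf⟩ := hcov _ hc
    have hqS : q ∈ S := by
      rcases List.mem_append.1 hq with hq | hq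
      · exact List.mem_append_left _ hq
      · obtain ⟨b, hb, rfl⟩ := List.mem_map.1 hq
        exact (hB b hb).1.1
    obtain ⟨b, hb, hbq⟩ := hbasis (q, w)
      ⟨⟨hqS, (mem_words.1 hw).2⟩, d, .head (mem_succs.1 hc') hd, hdf⟩
    exact ⟨b, List.mem_append_left _ (by simpa using hb), hbq⟩

/-- The configurations that can be reached from `c` in exactly `k` moves. -/
def iterSuccs (rs : List WordRule) (c : WordConfig) (k : ℕ) : List WordConfig :=
  Nat.rec [c] (fun _ L => L.flatMap (succs rs)) k

theorem reaches_iff_exists_iterSuccs {rs : List WordRule} {fs : List ℕ} {c : WordConfig} :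
    Reaches rs fs c ↔ ∃ k, ∃ d ∈ iterSuccs rs c k, d.1 ∈ fs := by
  have hsucc : ∀ k, iterSuccs rs c (k + 1) = (iterSuccs rs c k).flatMap (succs rs) := fun _ => rfl
  constructor
  · rintro ⟨d, hd, hdf⟩
    suffices h : ∃ k, d ∈ iterSuccs rs c k from h.imp fun k hk => ⟨d, hk, hdf⟩
    clear hdf
    induction hd with
    | refl => exact ⟨0, List.mem_singleton_self _⟩
    | tail _ hs ih =>
      obtain ⟨k, hk⟩ := ih
      exact ⟨k + 1, by rw [hsucc]; exact List.mem_flatMap.2 ⟨_, hk, mem_succs.2 hs⟩⟩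
  · rintro ⟨k, d, hd, hdf⟩
    refine ⟨d, ?_, hdf⟩
    clear hdf
    induction k generalizing d with
    | zero => rw [List.mem_singleton.1 hd]
    | succ k ih =>
      rw [hsucc] at hd
      obtain ⟨e, he, hed⟩ := List.mem_flatMap.1 hd
      exact (ih e he).tail (mem_succs.1 hed)

end WordSystem

/-! ### Primitive recursive predicates -/

section Primrec

variable {α β : Type*} [Primcodable α] [Primcodable β]

theorem PrimrecPred.forall_mem {f : α → List β} {P : α → β → Prop} (hf : Primrec f)
    (hP : PrimrecPred fun x : α × β => P x.1 x.2) : PrimrecPred fun a => ∀ b ∈ f a, P a b :=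
  (PrimrecRel.forall_mem_list (R := fun b a => P a b) hP.primrecRel.swap).comp hf Primrec.id

theorem PrimrecPred.exists_mem {f : α → List β} {P : α → β → Prop} (hf : Primrec f)
    (hP : PrimrecPred fun x : α × β => P x.1 x.2) : PrimrecPred fun a => ∃ b ∈ f a, P a b :=
  (PrimrecRel.exists_mem_list (R := fun b a => P a b) hP.primrecRel.swap).comp hf Primrec.id

theorem PrimrecPred.imp {P Q : α → Prop} (hP : PrimrecPred P) (hQ : PrimrecPred Q) :
    PrimrecPred fun a => P a → Q a :=
  (hP.not.or hQ).of_eq fun _ => imp_iff_not_or.symm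

theorem PrimrecPred.mem {f : α → β} {g : α → List β} (hf : Primrec f) (hg : Primrec g) :
    PrimrecPred fun a => f a ∈ g a :=
  (PrimrecPred.exists_mem (P := fun a b => b = f a) hg
    (Primrec.eq.comp Primrec.snd (hf.comp Primrec.fst))).of_eq fun a => by simp

theorem Primrec.list_filter {f : α → List β} {P : α → β → Prop} [∀ a, DecidablePred (P a)]
    (hf : Primrec f) (hP : PrimrecPred fun x : α × β => P x.1 x.2) :
    Primrec fun a => (f a).filter fun b => P a b :=
  letI : DecidableRel fun b a => P a b := fun b a => inferInstanceAs (Decidable (P a b))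
  (PrimrecRel.listFilter (R := fun b a => P a b) hP.primrecRel.swap).comp hf Primrec.id

theorem Primrec.list_sublists' : Primrec (List.sublists' : List α → List (List α)) := by
  have h : Primrec fun l : List α =>
      l.foldr (fun x L => L ++ L.map (List.cons x)) [[]] := by
    refine Primrec.list_foldr (h := fun _ (p : α × List (List α)) => p.2 ++ p.2.map (List.cons p.1))
      Primrec.id (Primrec.const _) ?_
    have h2 : Primrec fun t : List α × α × List (List α) => t.2.2 :=
      Primrec.snd.comp Primrec.snd
    refine Primrec.list_append.comp h2 (Primrec.list_map (g := fun t y => t.2.1 :: y) h2 ?_)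
    exact (Primrec.list_cons.comp (Primrec.fst.comp (Primrec.snd.comp Primrec.fst))
      Primrec.snd).to₂
  refine h.of_eq fun l => ?_
  induction l with
  | nil => rfl
  | cons x l ih => rw [List.foldr_cons, ih, List.sublists'_cons]

theorem PrimrecRel.list_sublist : PrimrecRel (List.Sublist : List α → List α → Prop) :=
  (PrimrecPred.mem Primrec.fst (Primrec.list_sublists'.comp Primrec.snd)).of_eq fun _ =>
    List.mem_sublists'

/-- A predicate is recursively enumerable if it asks for a certificate that passes a primitive
recursive test: the certificates are tried one after the other. -/
theorem PrimrecPred.rePred_exists {P : α → β → Prop}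
    (hP : PrimrecPred fun x : α × β => P x.1 x.2) : REPred fun a => ∃ b, P a b := by
  classical
  have hc : Primrec₂ fun (a : α) (n : ℕ) =>
      (Encodable.decode (α := β) n).bind fun b => if P a b then some () else none :=
    Primrec.option_bind (Primrec.decode.comp Primrec.snd)
      (Primrec.ite (hP.comp ((Primrec.fst.comp Primrec.fst).pair Primrec.snd))
        (Primrec.const _) (Primrec.const _)).to₂
  refine (Partrec.rfindOpt hc.to_comp).dom_re.of_eq fun a => ?_
  rw [Nat.rfindOpt_dom]
  constructor
  · rintro ⟨n, u, h⟩
    obtain ⟨b, -, hb⟩ := Option.bind_eq_some_iff.1 h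
    split_ifs at hb with hab
    exact ⟨b, hab⟩
  · rintro ⟨b, hb⟩
    exact ⟨Encodable.encode b, (), by simp [hb]⟩

end Primrec

/-! ### Reachability in word systems is decidable -/

namespace WordSystem

theorem primrec_strip : Primrec₂ strip :=
  Primrec.list_filter (P := fun (t : List ℕ × List ℕ) i => i ∉ t.1) Primrec.snd
    (PrimrecPred.mem Primrec.snd (Primrec.fst.comp Primrec.fst)).not

theorem primrecRel_le : PrimrecRel Le :=
  PrimrecPred.and (Primrec.eq.comp (Primrec.fst.comp Primrec.fst) (Primrec.fst.comp Primrec.snd))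
    (PrimrecRel.list_sublist.comp (Primrec.snd.comp Primrec.fst) (Primrec.snd.comp Primrec.snd))

theorem primrecRel_covers : PrimrecRel Covers :=
  PrimrecPred.exists_mem (P := fun (t : List WordConfig × WordConfig) b => Le b t.2) Primrec.fst
    (primrecRel_le.comp Primrec.snd (Primrec.snd.comp Primrec.fst))

theorem primrec_words : Primrec₂ words := by
  refine Primrec.nat_rec (g := fun (A : List (List ℕ)) (p : ℕ × List (List (List ℕ))) =>
    [] :: p.2.flatMap fun w => A.map fun x => x :: w) (Primrec.const _) ?_
  have h : Primrec fun t : List (List ℕ) × ℕ × List (List (List ℕ)) =>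
      t.2.2.flatMap fun w => t.1.map fun x => x :: w := by
    refine Primrec.list_flatMap (Primrec.snd.comp Primrec.snd) ?_
    refine Primrec.list_map (Primrec.fst.comp Primrec.fst) ?_
    exact (Primrec.list_cons.comp Primrec.snd (Primrec.snd.comp Primrec.fst)).to₂
  exact Primrec.list_cons.comp (Primrec.const []) h

theorem primrec_succs : Primrec₂ succs := by
  have hc : Primrec fun t : List WordRule × WordConfig => t.2 := Primrec.snd
  refine Primrec.list_cons.comp ((Primrec.fst.comp hc).pair
    (Primrec.list_cons.comp (Primrec.const []) (Primrec.snd.comp hc))) ?_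
  refine Primrec.list_flatMap Primrec.fst ?_
  have hc : Primrec fun t : (List WordRule × WordConfig) × WordRule => t.1.2 :=
    Primrec.snd.comp Primrec.fst
  refine Primrec.ite (Primrec.eq.comp (Primrec.fst.comp Primrec.snd) (Primrec.fst.comp hc)) ?_
    (Primrec.const [])
  refine Primrec.listFilterMap
    (Primrec.list_range.comp (Primrec.list_length.comp (Primrec.snd.comp hc))) ?_
  have hw : Primrec fun t : ((List WordRule × WordConfig) × WordRule) × ℕ => t.1.1.2.2 :=
    Primrec.snd.comp (hc.comp Primrec.fst)
  have hr : Primrec fun t : ((List WordRule × WordConfig) × WordRule) × ℕ => t.1.2.2 :=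
    Primrec.snd.comp (Primrec.snd.comp Primrec.fst)
  have hr2 := Primrec.snd.comp hr
  have hr3 := Primrec.snd.comp hr2
  refine Primrec.ite (Primrec.eq.comp (Primrec.list_getElem?.comp hw Primrec.snd)
    (Primrec.option_some.comp (Primrec.fst.comp hr))) ?_ (Primrec.const none)
  refine Primrec.option_some.comp ((Primrec.snd.comp hr3).pair ?_)
  refine Primrec.list_set.comp (Primrec.list_map hw ?_)
    (Primrec.snd.pair (Primrec.fst.comp hr2))
  exact (primrec_strip.comp (Primrec.fst.comp (hr3.comp Primrec.fst)) Primrec.snd).to₂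

theorem primrec_iterSuccs :
    Primrec₂ fun (t : List WordRule × WordConfig) k => iterSuccs t.1 t.2 k := by
  refine Primrec.nat_rec (g := fun (t : List WordRule × WordConfig) (p : ℕ × List WordConfig) =>
    p.2.flatMap (succs t.1)) (Primrec.list_cons.comp Primrec.snd (Primrec.const [])) ?_
  refine Primrec.list_flatMap
    (α := (List WordRule × WordConfig) × ℕ × List WordConfig) (Primrec.snd.comp Primrec.snd) ?_
  exact (primrec_succs.comp (Primrec.fst.comp (Primrec.fst.comp Primrec.fst)) Primrec.snd).to₂

variable {α : Type*} [Primcodable α] {A : α → List (List ℕ)} {rs : α → List WordRule}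
  {fs : α → List ℕ} {c₀ : α → WordConfig}

theorem rePred_reaches (hrs : Primrec rs) (hfs : Primrec fs) (hc₀ : Primrec c₀) :
    REPred fun a => Reaches (rs a) (fs a) (c₀ a) := by
  refine REPred.of_eq (PrimrecPred.rePred_exists (β := ℕ)
    (P := fun a k => ∃ d ∈ iterSuccs (rs a) (c₀ a) k, d.1 ∈ fs a) ?_)
    fun a => reaches_iff_exists_iterSuccs.symm
  exact PrimrecPred.exists_mem
    (primrec_iterSuccs.comp ((hrs.pair hc₀).comp Primrec.fst) Primrec.snd)
    (PrimrecPred.mem (Primrec.fst.comp Primrec.snd) (hfs.comp (Primrec.fst.comp Primrec.fst)))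

theorem primrecPred_certifies (hA : Primrec A) (hrs : Primrec rs) (hfs : Primrec fs)
    (hc₀ : Primrec c₀) :
    PrimrecPred fun x : α × ℕ × List WordConfig =>
      Certifies (A x.1) (rs x.1) (fs x.1) (c₀ x.1) x.2.1 x.2.2 := by
  have ha : Primrec fun x : α × ℕ × List WordConfig => x.1 := Primrec.fst
  have hK : Primrec fun x : α × ℕ × List WordConfig => x.2.1 := Primrec.fst.comp Primrec.snd
  have hB : Primrec fun x : α × ℕ × List WordConfig => x.2.2 := Primrec.snd.comp Primrec.snd
  refine PrimrecPred.and ?_ (PrimrecPred.and ?_ (PrimrecPred.and ?_ ?_))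
  · exact PrimrecPred.forall_mem hB (Primrec.nat_lt.comp
      (Primrec.list_length.comp (Primrec.snd.comp Primrec.snd)) (hK.comp Primrec.fst))
  · exact PrimrecPred.forall_mem (hfs.comp ha)
      (PrimrecPred.mem (Primrec.snd.pair (Primrec.const [])) (hB.comp Primrec.fst))
  · exact (primrecRel_covers.comp hB (hc₀.comp ha)).not
  · refine PrimrecPred.forall_mem (Primrec.list_append.comp
      (Primrec.list_map (hrs.comp ha) (Primrec.fst.comp Primrec.snd).to₂)
      (Primrec.list_map hB (Primrec.fst.comp Primrec.snd).to₂)) ?_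
    refine PrimrecPred.forall_mem (P := fun t w => ∀ c' ∈ succs (rs t.1.1) (t.2, w),
      Covers t.1.2.2 c' → Covers t.1.2.2 (t.2, w))
      (primrec_words.comp ((hA.comp ha).comp Primrec.fst) (hK.comp Primrec.fst)) ?_
    have hq : Primrec fun t : ((α × ℕ × List WordConfig) × ℕ) × List (List ℕ) => (t.1.2, t.2) :=
      (Primrec.snd.comp Primrec.fst).pair Primrec.snd
    refine PrimrecPred.forall_mem (P := fun t c' => Covers t.1.1.2.2 c' →
      Covers t.1.1.2.2 (t.1.2, t.2))
      (primrec_succs.comp (hrs.comp (ha.comp (Primrec.fst.comp Primrec.fst))) hq) ?_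
    have hB' := hB.comp (Primrec.fst.comp (Primrec.fst.comp (Primrec.fst
      (α := ((α × ℕ × List WordConfig) × ℕ) × List (List ℕ)) (β := WordConfig))))
    exact PrimrecPred.imp (primrecRel_covers.comp hB' Primrec.snd)
      (primrecRel_covers.comp hB' (hq.comp Primrec.fst))

/-- Runs to a state in `fs` and certificates of unreachability can both be searched for, and exactly
one of the two searches succeeds. -/
theorem computablePred_not_reaches (hA : Primrec A) (hrs : Primrec rs) (hfs : Primrec fs)
    (hc₀ : Primrec c₀) (hwf : ∀ a, WellFormed (A a) (rs a)) (hmem : ∀ a, ∀ x ∈ (c₀ a).2, x ∈ A a) :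
    ComputablePred fun a => ¬ Reaches (rs a) (fs a) (c₀ a) := by
  refine ComputablePred.not (ComputablePred.computable_iff_re_compl_re'.2
    ⟨rePred_reaches hrs hfs hc₀, ?_⟩)
  refine REPred.of_eq (PrimrecPred.rePred_exists (P := fun a (t : ℕ × List WordConfig) =>
    Certifies (A a) (rs a) (fs a) (c₀ a) t.1 t.2) (primrecPred_certifies hA hrs hfs hc₀))
    fun a => ⟨?_, ?_⟩
  · rintro ⟨t, ht⟩
    exact ht.not_reaches (hwf a) (hmem a)
  · intro h
    obtain ⟨K, B, hKB⟩ := exists_certifies h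
    exact ⟨(K, B), hKB⟩

end WordSystem

/-! ### The letters of the names of an assignment -/

section Letters

variable {N : Type*} [DecidableEq N] {m n : ℕ}

/-- The letter that stands for the set `decodePlaces m n X` of places, where `p = m + n`: the list
of its elements in increasing order, so that equal sets have equal letters. -/
def normPlaces (p : ℕ) (X : List ℕ) : List ℕ := (List.range p).filter (· ∈ X)

/-- The places that hold the name `a`, in increasing order. -/
def Assignment.letter (H : Assignment N m n) (a : N) : List ℕ :=
  (List.range (m + n)).filter fun i => ∃ h : i < m + n, a ∈ H.val ⟨i, h⟩

theorem Assignment.letter_eq_iff {H : Assignment N m n} {a : N} {p : ℕ → Prop} [DecidablePred p] :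
    H.letter a = (List.range (m + n)).filter (p ·) ↔ ∀ i : Place m n, a ∈ H.val i ↔ p i := by
  constructor
  · intro h i
    have := congrArg ((i : ℕ) ∈ ·) h
    simpa [letter] using this
  · intro h
    refine List.filter_congr fun i hi => ?_
    have hi : i < m + n := List.mem_range.1 hi
    simpa [hi] using h ⟨i, hi⟩

/-- The letter of a name tells which transitions accept it. -/
theorem Assignment.letter_eq_normPlaces {H : Assignment N m n} {a : N} {X : List ℕ} :
    H.letter a = normPlaces (m + n) X ↔ a ∈ H.at_ (decodePlaces m n X) := by
  rw [normPlaces, letter_eq_iff]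
  simp only [at_, decodePlaces, Finset.mem_filter, Finset.mem_univ, true_and, Set.mem_sdiff,
    Set.mem_iInter, SetLike.mem_coe, Set.mem_iUnion, not_exists]
  constructor
  · intro h
    exact ⟨fun i => (h i).2, fun i hi hia => hi ((h i).1 hia)⟩
  · rintro ⟨h1, h2⟩ i
    exact ⟨fun h => by_contra fun hi => h2 i hi h, h1 i⟩

theorem Assignment.strip_letter {H : Assignment N m n} {a : N} {R : List ℕ} :
    WordSystem.strip R (H.letter a) = (List.range (m + n)).filter fun i =>
      i ∉ R ∧ ∃ h : i < m + n, a ∈ H.val ⟨i, h⟩ := by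
  rw [WordSystem.strip, letter, List.filter_filter]
  exact List.filter_congr fun i _ => by simp

theorem Assignment.letter_reset (H : Assignment N m n) (a : N) (X : List ℕ) :
    (H.reset (decodePlaces m n X)).letter a = WordSystem.strip X (H.letter a) := by
  rw [strip_letter, letter_eq_iff]
  intro i
  by_cases hi : (i : ℕ) ∈ X <;> simp [reset, decodePlaces, hi]

theorem Assignment.letter_move_self (H : Assignment N m n) (a : N) (X : List ℕ) :
    (H.move a (decodePlaces m n X)).letter a = normPlaces (m + n) X := by
  rw [normPlaces, letter_eq_iff]
  intro i
  by_cases hi : (i : ℕ) ∈ X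
  · by_cases hm : (i : ℕ) < m <;> simp [move, decodePlaces, hi, hm]
  · simp [move, decodePlaces, hi]

/-- A name that enters registers pushes all other names out of them. -/
theorem Assignment.letter_move_of_ne (H : Assignment N m n) {a b : N} (hb : b ≠ a) (X : List ℕ) :
    (H.move a (decodePlaces m n X)).letter b =
      WordSystem.strip (X.filter (m ≤ ·)) (H.letter b) := by
  rw [strip_letter, letter_eq_iff]
  intro i
  by_cases hi : (i : ℕ) ∈ X
  · by_cases hm : (i : ℕ) < m
    · simp [move, decodePlaces, hi, hm, hb]
    · simp [move, decodePlaces, hi, hm, hb, not_lt.1 hm]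
  · simp [move, decodePlaces, hi, hb]

/-- The word `w` lists the letters of finitely many names, among them all names in `H`. -/
def Assignment.Represents (H : Assignment N m n) (w : List (List ℕ)) : Prop :=
  ∃ l : List N, l.Nodup ∧ w = l.map H.letter ∧ ∀ a ∉ l, H.letter a = []

/-- Finitely many names are listed, so some other name is in no place and may be added. -/
theorem Assignment.Represents.insert [Infinite N] {H : Assignment N m n} {w : List (List ℕ)}
    (h : H.Represents w) : H.Represents ([] :: w) := by
  obtain ⟨l, hl, rfl, hn⟩ := h
  obtain ⟨a, ha⟩ := Infinite.exists_notMem_finset l.toFinset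
  rw [List.mem_toFinset] at ha
  exact ⟨a :: l, hl.cons ha, by simp [hn a ha], fun b hb => hn b fun h =>
    hb (List.mem_cons_of_mem _ h)⟩

theorem Assignment.Represents.reset {H : Assignment N m n} {w : List (List ℕ)}
    (h : H.Represents w) (X : List ℕ) :
    (H.reset (decodePlaces m n X)).Represents (w.map (WordSystem.strip X)) := by
  obtain ⟨l, hl, rfl, hn⟩ := h
  refine ⟨l, hl, ?_, fun a ha => ?_⟩
  · simp [letter_reset]
  · rw [letter_reset, hn a ha, WordSystem.strip, List.filter_nil]

theorem Assignment.Represents.move {H : Assignment N m n} {s t : List N} {a : N}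
    (hl : (s ++ a :: t).Nodup) (hn : ∀ b ∉ s ++ a :: t, H.letter b = []) (X : List ℕ) :
    (H.move a (decodePlaces m n X)).Represents
      ((s.map H.letter).map (WordSystem.strip (X.filter (m ≤ ·))) ++ normPlaces (m + n) X ::
        (t.map H.letter).map (WordSystem.strip (X.filter (m ≤ ·)))) := by
  have ha := List.nodup_middle.1 hl
  rw [List.nodup_cons, List.mem_append, not_or] at ha
  refine ⟨s ++ a :: t, hl, ?_, fun b hb => ?_⟩
  · rw [List.map_append, List.map_cons, letter_move_self, List.map_map, List.map_map]
    refine congrArg₂ (· ++ ·) ?_ (congrArg _ ?_)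
    · exact List.map_congr_left fun b hb =>
        (letter_move_of_ne H (ne_of_mem_of_not_mem hb ha.1.1) X).symm
    · exact List.map_congr_left fun b hb =>
        (letter_move_of_ne H (ne_of_mem_of_not_mem hb ha.1.2) X).symm
  · have hba : b ≠ a := by
      rintro rfl
      simp at hb
    rw [letter_move_of_ne H hba, hn b hb, WordSystem.strip, List.filter_nil]

end Letters

/-! ### The word system of an automaton -/

theorem HRA.Run.trans {N : Type*} [DecidableEq N] {m n : ℕ} {A : HRA N m n} {e₁ e₂ e₃ : A.Config}
    {u v : List N} (h : A.Run e₁ u e₂) (h' : A.Run e₂ v e₃) : A.Run e₁ (u ++ v) e₃ := by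
  induction h with
  | refl => exact h'
  | step hs _ ih => rw [List.append_assoc]; exact .step hs (ih h')

namespace HRACode

/-- The rule of a transition. Accepting a name rewrites its letter and strips the registers it
enters from the other letters. A reset is a rule that rewrites the empty letter to itself. -/
def rule (m n : ℕ) (t : ℕ × LabelCode × ℕ) : WordRule :=
  (t.1, Sum.casesOn (motive := fun _ => List ℕ × List ℕ × List ℕ × ℕ) t.2.1
    (fun p => (normPlaces (m + n) p.1, normPlaces (m + n) p.2, p.2.filter (m ≤ ·), t.2.2))
    (fun X => ([], [], X, t.2.2)))

/-- The rules of an automaton. Transitions to numbers that are not states are dropped, since a run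
of the word system might otherwise pass through such a number. -/
def rules (m n : ℕ) (c : HRACode) : List WordRule :=
  (c.2.2.2.1.filter fun t => t.2.2 ≤ c.1).map (rule m n)

/-- The alphabet of all sets of places. -/
def alphabet (m n : ℕ) : List (List ℕ) := (List.range (m + n)).sublists'

/-- The places that hold the `j`-th name in the initial assignment. -/
def initLetter (m n : ℕ) (c : HRACode) (j : ℕ) : List ℕ :=
  (List.range (m + n)).filter fun i =>
    (i < m ∧ j ∈ c.2.1.getD i []) ∨ (¬ i < m ∧ c.2.2.1.getD (i - m) none = some j)

/-- A strict bound for the numbers of the names in the initial assignment. -/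
def nameBound (c : HRACode) : ℕ :=
  (c.2.1.flatten ++ c.2.2.1.flatMap Option.toList).foldr (fun a s => a + s + 1) 0

/-- The initial configuration of the word system: the names with numbers below the bound are listed,
including those that are in no place. -/
def initConfig (m n : ℕ) (c : HRACode) : WordConfig :=
  (0, (List.range c.nameBound).map (c.initLetter m n))

theorem wellFormed (m n : ℕ) (c : HRACode) :
    WordSystem.WellFormed (alphabet m n) (c.rules m n) where
  nil_mem := List.mem_sublists'.2 (List.nil_sublist _)
  strip_mem x hx R := List.mem_sublists'.2 (List.filter_sublist.trans (List.mem_sublists'.1 hx))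
  write_mem := by
    rintro r hr
    obtain ⟨⟨q, (p | X), q'⟩, -, rfl⟩ := List.mem_map.1 hr
    · exact List.mem_sublists'.2 List.filter_sublist
    · exact List.mem_sublists'.2 (List.nil_sublist _)

theorem initConfig_mem_alphabet (m n : ℕ) (c : HRACode) :
    ∀ x ∈ (c.initConfig m n).2, x ∈ alphabet m n := by
  intro x hx
  obtain ⟨j, -, rfl⟩ := List.mem_map.1 hx
  exact List.mem_sublists'.2 List.filter_sublist

section Simulation

variable {N : Type*} [DecidableEq N] [Denumerable N] {m n : ℕ}

theorem lt_nameBound {c : HRACode} {j : ℕ}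
    (h : j ∈ c.2.1.flatten ++ c.2.2.1.flatMap Option.toList) : j < c.nameBound := by
  rw [nameBound]
  generalize c.2.1.flatten ++ c.2.2.1.flatMap Option.toList = l at h
  induction l with
  | nil => simp at h
  | cons a l ih =>
    rw [List.foldr_cons]
    rcases List.mem_cons.1 h with rfl | h
    · omega
    · have := ih h
      omega

/-- `initLetter` computes the letters of the initial assignment. -/
theorem letter_decodeAssignment (c : HRACode) (j : ℕ) :
    (decodeAssignment N m n c.2.1 c.2.2.1).letter (Denumerable.ofNat N j) =
      c.initLetter m n j := by
  have hinj : ∀ x y : ℕ, Denumerable.ofNat N x = Denumerable.ofNat N y ↔ x = y := fun x y =>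
    ⟨fun h => by simpa using congrArg Encodable.encode h, fun h => h ▸ rfl⟩
  rw [initLetter, Assignment.letter_eq_iff]
  intro i
  by_cases hi : (i : ℕ) < m
  · simp [decodeAssignment, hi, hinj]
  · simp [decodeAssignment, hi, hinj]

theorem represents_initConfig (c : HRACode) :
    (decodeAssignment N m n c.2.1 c.2.2.1).Represents (c.initConfig m n).2 := by
  refine ⟨(List.range c.nameBound).map (Denumerable.ofNat N), ?_, ?_, fun a ha => ?_⟩
  · exact List.nodup_range.map fun x y h => by simpa using congrArg Encodable.encode h
  · simp [initConfig, letter_decodeAssignment]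
  · obtain ⟨j, rfl⟩ : ∃ j, Denumerable.ofNat N j = a := ⟨Encodable.encode a, by simp⟩
    have hj : ¬ j < c.nameBound := fun h =>
      ha (List.mem_map_of_mem (List.mem_range.2 h))
    rw [letter_decodeAssignment, initLetter, List.filter_eq_nil_iff]
    intro i _ h
    rw [decide_eq_true_iff] at h
    refine hj (lt_nameBound ?_)
    rcases h with ⟨-, h⟩ | ⟨-, h⟩
    · rw [List.getD_eq_getElem?_getD] at h
      cases hl : c.2.1[i]? with
      | none => simp [hl] at h
      | some l =>
        rw [hl, Option.getD_some] at h
        exact List.mem_append_left _ (List.mem_flatten.2 ⟨l, List.mem_of_getElem? hl, h⟩)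
    · rw [List.getD_eq_getElem?_getD] at h
      cases hl : c.2.2.1[i - m]? with
      | none => simp [hl] at h
      | some o =>
        rw [hl, Option.getD_some] at h
        exact List.mem_append_right _
          (List.mem_flatMap.2 ⟨o, List.mem_of_getElem? hl, by simp [h]⟩)

theorem rule_mem_rules {c : HRACode} {t : ℕ × LabelCode × ℕ} (ht : t ∈ c.2.2.2.1)
    (hk : t.2.2 ≤ c.1) : rule m n t ∈ c.rules m n :=
  List.mem_map_of_mem (List.mem_filter.2 ⟨ht, by simpa using hk⟩)

open WordSystem in
/-- The word system simulates the automaton. -/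
theorem exists_wordStep {c : HRACode} {q q' : (c.toHRA N m n).State} {H H' : Assignment N m n}
    {x : Option N} (h : (c.toHRA N m n).Step (q, H) x (q', H')) {w : List (List ℕ)}
    (hw : H.Represents w) :
    ∃ w', Relation.ReflTransGen (Step (c.rules m n)) (Fin.val q, w) (Fin.val q', w') ∧
      H'.Represents w' := by
  cases h with
  | @accept _ _ X X' _ a ht ha =>
    obtain ⟨⟨p, l, p'⟩, hs, h1, h2, h3⟩ := ht
    dsimp only at h1 h2 h3
    obtain ⟨Y, Y'⟩ | Y := l
    swap
    · cases h2
    obtain ⟨rfl, rfl⟩ : decodePlaces m n Y = X ∧ decodePlaces m n Y' = X' := by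
      simpa [decodeLabel] using h2
    have hr := rule_mem_rules (m := m) (n := n) hs (h3.trans_le (Nat.le_of_lt_succ q'.isLt))
    subst h1 h3
    have ha' := Assignment.letter_eq_normPlaces.2 ha
    -- the name `a` is noticed, if it is not yet in the list
    obtain ⟨w, hqw, l, hl, rfl, hn, hal⟩ : ∃ w₁, Relation.ReflTransGen (Step (c.rules m n))
        (Fin.val q, w) (Fin.val q, w₁) ∧ ∃ l : List N, l.Nodup ∧ w₁ = l.map H.letter ∧
          (∀ b ∉ l, H.letter b = []) ∧ a ∈ l := by
      obtain ⟨l, hl, rfl, hn⟩ := hw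
      by_cases hal : a ∈ l
      · exact ⟨_, .refl, l, hl, rfl, hn, hal⟩
      · -- here `a` is in no place: all names that are not listed have the empty letter
        refine ⟨_, .single (.insert _ _), a :: l, hl.cons hal, ?_, fun b hb => ?_, by simp⟩
        · simp [hn a hal]
        · exact hn b fun h => hb (List.mem_cons_of_mem _ h)
    obtain ⟨s, t, rfl⟩ := List.append_of_mem hal
    refine ⟨_, hqw.tail ?_, Assignment.Represents.move hl hn Y'⟩
    have := Step.rule hr (s.map H.letter) (t.map H.letter)
    rwa [← ha', ← List.map_cons (f := H.letter), ← List.map_append] at this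
  | @reset _ _ X _ ht =>
    obtain ⟨⟨p, l, p'⟩, hs, h1, h2, h3⟩ := ht
    dsimp only at h1 h2 h3
    obtain Y | Y := l
    · cases h2
    obtain rfl : decodePlaces m n Y = X := by
      simpa [decodeLabel] using h2
    have hr := rule_mem_rules (m := m) (n := n) hs (h3.trans_le (Nat.le_of_lt_succ q'.isLt))
    subst h1 h3
    have hN : Infinite N := Denumerable.instInfinite
    -- an unlisted name provides the empty letter that the rule of the reset rewrites
    refine ⟨[] :: w.map (strip Y), ?_, (hw.reset Y).insert⟩
    exact .tail (.single (.insert _ w)) (.rule hr [] w)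

open WordSystem in
/-- The automaton simulates the word system. -/
theorem exists_step {c : HRACode} {q : (c.toHRA N m n).State} {w : List (List ℕ)} {d : WordConfig}
    (h : Step (c.rules m n) (Fin.val q, w) d) {H : Assignment N m n} (hw : H.Represents w) :
    ∃ (q' : (c.toHRA N m n).State) (H' : Assignment N m n) (u : List N),
      (c.toHRA N m n).Run (q, H) u (q', H') ∧ Fin.val q' = d.1 ∧ H'.Represents d.2 := by
  have hN : Infinite N := Denumerable.instInfinite
  generalize hp : Fin.val q = p at h
  cases h with
  | insert p w => exact ⟨q, H, _, .refl _, hp, hw.insert⟩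
  | @rule _ x x' R p' hr u v =>
    obtain ⟨⟨p₁, l, p₂⟩, ht, hr⟩ := List.mem_map.1 hr
    obtain ⟨ht, hk⟩ := List.mem_filter.1 ht
    have hk : p₂ < c.1 + 1 := Nat.lt_succ_of_le (by simpa using hk)
    let q' : (c.toHRA N m n).State := ⟨p₂, hk⟩
    obtain ⟨Y, Y'⟩ | Y := l
    · simp only [HRACode.rule, Prod.mk.injEq] at hr
      obtain ⟨rfl, rfl, rfl, rfl, rfl⟩ := hr
      obtain ⟨l, hl, hlw, hn⟩ := hw
      obtain ⟨s, t, rfl, hs, ht'⟩ := List.map_eq_append_iff.1 hlw.symm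
      obtain ⟨a, t, rfl, ha, ht'⟩ := List.map_eq_cons_iff.1 ht'
      have hstep : (c.toHRA N m n).Step (q, H) (some a) (q', H.move a (decodePlaces m n Y')) :=
        .accept ⟨_, ht, hp.symm, rfl, rfl⟩ (Assignment.letter_eq_normPlaces.1 ha)
      exact ⟨q', _, _, .step hstep (.refl _), rfl, hs ▸ ht' ▸ .move hl hn Y'⟩
    · simp only [HRACode.rule, Prod.mk.injEq] at hr
      obtain ⟨rfl, rfl, rfl, rfl, rfl⟩ := hr
      have hstep : (c.toHRA N m n).Step (q, H) none (q', H.reset (decodePlaces m n Y)) :=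
        .reset ⟨_, ht, hp.symm, rfl, rfl⟩
      refine ⟨q', _, _, .step hstep (.refl _), rfl, ?_⟩
      simpa [strip] using hw.reset Y

theorem reaches_of_run {c : HRACode} {e e' : (c.toHRA N m n).Config} {u : List N}
    (h : (c.toHRA N m n).Run e u e') {w : List (List ℕ)} (hw : e.2.Represents w)
    {fs : List ℕ} (hfs : Fin.val e'.1 ∈ fs) :
    WordSystem.Reaches (c.rules m n) fs (Fin.val e.1, w) := by
  induction h generalizing w with
  | refl e => exact ⟨_, .refl, hfs⟩
  | @step e₁ e₂ e₃ _ _ hs _ ih =>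
    obtain ⟨w', h1, h2⟩ := exists_wordStep (q := e₁.1) (q' := e₂.1) hs hw
    obtain ⟨d, hd, hdf⟩ := ih h2 hfs
    exact ⟨d, h1.trans hd, hdf⟩

theorem exists_run_of_reaches {c : HRACode} {fs : List ℕ} {d : WordConfig}
    (h : WordSystem.Reaches (c.rules m n) fs d) {q : (c.toHRA N m n).State} (hq : Fin.val q = d.1)
    {H : Assignment N m n} (hw : H.Represents d.2) :
    ∃ (q' : (c.toHRA N m n).State) (H' : Assignment N m n) (u : List N),
      (c.toHRA N m n).Run (q, H) u (q', H') ∧ Fin.val q' ∈ fs := by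
  obtain ⟨e, hde, hef⟩ := h
  induction hde using Relation.ReflTransGen.head_induction_on generalizing q H with
  | refl => exact ⟨q, H, _, .refl _, hq ▸ hef⟩
  | @head d₁ d₂ hs _ ih =>
    obtain ⟨q₁, H₁, u, hr, hq₁, hw₁⟩ :=
      exists_step (q := q) (w := d₁.2) (d := d₂) (by rwa [hq]) hw
    obtain ⟨q₂, H₂, v, hr', hq₂⟩ := ih hq₁ hw₁
    exact ⟨q₂, H₂, _, hr.trans hr', hq₂⟩

/-- The automaton reaches a final state if and only if its word system does. -/
theorem language_eq_empty_iff (c : HRACode) :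
    (c.toHRA N m n).language = ∅ ↔
      ¬ WordSystem.Reaches (c.rules m n) c.2.2.2.2 (c.initConfig m n) := by
  rw [← not_iff_not, not_not, ← ne_eq, ← Set.nonempty_iff_ne_empty]
  constructor
  · rintro ⟨w, q, H, hr, hq⟩
    exact reaches_of_run hr (represents_initConfig c) hq
  · intro h
    obtain ⟨q, H, u, hr, hq⟩ := exists_run_of_reaches (N := N) h
      (q := (c.toHRA N m n).init) rfl (represents_initConfig c)
    exact ⟨u, q, H, hr, hq⟩

end Simulation

/-! ### The word system is computed from the code -/

theorem primrec_normPlaces : Primrec₂ normPlaces :=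
  Primrec.list_filter (P := fun (t : ℕ × List ℕ) i => i ∈ t.2)
    (Primrec.list_range.comp Primrec.fst)
    (PrimrecPred.mem Primrec.snd (Primrec.snd.comp Primrec.fst))

theorem primrec_rule : Primrec fun x : (ℕ × ℕ) × ℕ × LabelCode × ℕ => rule x.1.1 x.1.2 x.2 := by
  have ht : Primrec fun x : (ℕ × ℕ) × ℕ × LabelCode × ℕ => x.2 := Primrec.snd
  have hp : Primrec fun x : (ℕ × ℕ) × ℕ × LabelCode × ℕ => x.1.1 + x.1.2 :=
    Primrec.nat_add.comp (Primrec.fst.comp Primrec.fst) (Primrec.snd.comp Primrec.fst)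
  have hm : Primrec fun x : (ℕ × ℕ) × ℕ × LabelCode × ℕ => x.1.1 := Primrec.fst.comp Primrec.fst
  have hq' : Primrec fun x : (ℕ × ℕ) × ℕ × LabelCode × ℕ => x.2.2.2 :=
    Primrec.snd.comp (Primrec.snd.comp ht)
  refine (Primrec.fst.comp ht).pair (Primrec.sumCasesOn
    (g := fun x p => (normPlaces (x.1.1 + x.1.2) p.1, normPlaces (x.1.1 + x.1.2) p.2,
      p.2.filter (x.1.1 ≤ ·), x.2.2.2))
    (h := fun x X => ([], [], X, x.2.2.2)) (Primrec.fst.comp (Primrec.snd.comp ht)) ?_ ?_)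
  · have h2 : Primrec fun y : ((ℕ × ℕ) × ℕ × LabelCode × ℕ) × (List ℕ × List ℕ) => y.2.2 :=
      Primrec.snd.comp Primrec.snd
    refine (primrec_normPlaces.comp (hp.comp Primrec.fst) (Primrec.fst.comp Primrec.snd)).pair
      ((primrec_normPlaces.comp (hp.comp Primrec.fst) h2).pair
        (Primrec.pair ?_ (hq'.comp Primrec.fst)))
    exact Primrec.list_filter h2 (Primrec.nat_le.comp (hm.comp (Primrec.fst.comp Primrec.fst))
      Primrec.snd)
  · exact (Primrec.const []).pair ((Primrec.const []).pair
      (Primrec.snd.pair (hq'.comp Primrec.fst)))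

theorem primrec_rules : Primrec fun x : ℕ × ℕ × HRACode => rules x.1 x.2.1 x.2.2 := by
  have hc : Primrec fun x : ℕ × ℕ × HRACode => x.2.2 := Primrec.snd.comp Primrec.snd
  have hts : Primrec fun x : ℕ × ℕ × HRACode => x.2.2.2.2.2.1 :=
    Primrec.fst.comp (Primrec.snd.comp (Primrec.snd.comp (Primrec.snd.comp hc)))
  refine Primrec.list_map (Primrec.list_filter hts ?_) ?_
  · exact Primrec.nat_le.comp (Primrec.snd.comp (Primrec.snd.comp Primrec.snd))
      (Primrec.fst.comp (hc.comp Primrec.fst))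
  · have h : Primrec fun y : (ℕ × ℕ × HRACode) × ℕ × LabelCode × ℕ =>
        ((y.1.1, y.1.2.1), y.2) :=
      ((Primrec.fst.comp Primrec.fst).pair
        (Primrec.fst.comp (Primrec.snd.comp Primrec.fst))).pair Primrec.snd
    have h' := primrec_rule.comp h
    exact h'

theorem primrec_alphabet : Primrec₂ alphabet :=
  Primrec.list_sublists'.comp (Primrec.list_range.comp Primrec.nat_add)

theorem primrec_initLetter :
    Primrec fun y : (ℕ × ℕ × HRACode) × ℕ => initLetter y.1.1 y.1.2.1 y.1.2.2 y.2 := by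
  have hm : Primrec fun y : (ℕ × ℕ × HRACode) × ℕ => y.1.1 := Primrec.fst.comp Primrec.fst
  have hn : Primrec fun y : (ℕ × ℕ × HRACode) × ℕ => y.1.2.1 :=
    Primrec.fst.comp (Primrec.snd.comp Primrec.fst)
  have hc : Primrec fun y : (ℕ × ℕ × HRACode) × ℕ => y.1.2.2 :=
    Primrec.snd.comp (Primrec.snd.comp Primrec.fst)
  refine Primrec.list_filter (Primrec.list_range.comp (Primrec.nat_add.comp hm hn)) ?_
  have hi : Primrec fun z : ((ℕ × ℕ × HRACode) × ℕ) × ℕ => z.2 := Primrec.snd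
  have hm := hm.comp (Primrec.fst (β := ℕ))
  have hc := hc.comp (Primrec.fst (β := ℕ))
  have hj : Primrec fun z : ((ℕ × ℕ × HRACode) × ℕ) × ℕ => z.1.2 := Primrec.snd.comp Primrec.fst
  have hlt := Primrec.nat_lt.comp hi hm
  refine (hlt.and (PrimrecPred.mem hj ?_)).or (hlt.not.and (Primrec.eq.comp ?_ ?_))
  · exact (Primrec.list_getD []).comp (Primrec.fst.comp (Primrec.snd.comp hc)) hi
  · exact (Primrec.list_getD none).comp (Primrec.fst.comp (Primrec.snd.comp (Primrec.snd.comp hc)))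
      (Primrec.nat_sub.comp hi hm)
  · exact Primrec.option_some.comp hj

theorem primrec_nameBound : Primrec nameBound := by
  refine Primrec.list_foldr (h := fun _ (p : ℕ × ℕ) => p.1 + p.2 + 1)
    (Primrec.list_append.comp ?_ ?_) (Primrec.const 0) ?_
  · exact Primrec.list_flatten.comp (Primrec.fst.comp Primrec.snd)
  · exact Primrec.list_flatMap (Primrec.fst.comp (Primrec.snd.comp Primrec.snd))
      (Primrec.optionToList.comp Primrec.snd).to₂
  · exact (Primrec.succ.comp (Primrec.nat_add.comp (Primrec.fst.comp Primrec.snd)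
      (Primrec.snd.comp Primrec.snd))).to₂

theorem primrec_initConfig :
    Primrec fun x : ℕ × ℕ × HRACode => initConfig x.1 x.2.1 x.2.2 :=
  (Primrec.const 0).pair (Primrec.list_map
    (Primrec.list_range.comp (primrec_nameBound.comp (Primrec.snd.comp Primrec.snd)))
    primrec_initLetter.to₂)

end HRACode

/-- Language emptiness of history-register automata is decidable: there is an algorithm that,
given `m`, `n` and (the code of) an `(m, n)`-HRA, decides whether it accepts no word. -/
theorem mainTheorem1 {N : Type*} [DecidableEq N] [Denumerable N] :
    ComputablePred fun x : ℕ × ℕ × HRACode =>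
      (x.2.2.toHRA N x.1 x.2.1).language = ∅ := by
  refine ComputablePred.of_eq (WordSystem.computablePred_not_reaches
    (A := fun x : ℕ × ℕ × HRACode => HRACode.alphabet x.1 x.2.1)
    (fs := fun x => x.2.2.2.2.2.2)
    (HRACode.primrec_alphabet.comp Primrec.fst (Primrec.fst.comp Primrec.snd))
    HRACode.primrec_rules ?_ HRACode.primrec_initConfig
    (fun x => HRACode.wellFormed x.1 x.2.1 x.2.2)
    fun x => HRACode.initConfig_mem_alphabet x.1 x.2.1 x.2.2)
    fun x => (HRACode.language_eq_empty_iff x.2.2).symm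
  exact Primrec.snd.comp (Primrec.snd.comp (Primrec.snd.comp (Primrec.snd.comp
    (Primrec.snd.comp Primrec.snd))))
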